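/- Let $\mathbf X$ be a set, let $Y_1, Y_2 \in \mathbb R$, and let $\mathcal F$ be a reproducing kernel Hilbert space of real functions on $\mathbf X$, with norm $\|\cdot\|$ and kernel $k:\mathbf X\times\mathbf X\to\mathbb R$. Consider online regression with discounting: at each step $t=1,2,\dots$ a discount factor $\alpha_{t-1}\in(0,1]$ and an input $x_t\in\mathbf X$ are announced, then Learner announces a prediction $\gamma_t\in\mathbb R$, and then an outcome $y_t\in[Y_1,Y_2]$ is announced. A strategy for Learner determines $\gamma_t$ from $\alpha_0,\dots,\alpha_{t-1}$, $x_1,\dots,x_t$ and $y_1,\dots,y_{t-1}$. Put $\beta_1=1$ and $\beta_t=1/(\alpha_1\cdots\alpha_{t-1})$. For every $T\ge 1$ let $W_T=\operatorname{diag}(\beta_1/\beta_T,\dots,\beta_T/\beta_T)$, let $\mathbf K_T=(k(x_i,x_j))_{i,j=1,\dots,T}$ be the kernel matrix of the inputs, and let $I$ be the $T\times T$ unit matrix. For every $a>0$ there exists a strategy for Learner such that, for all sequences of discount factors, inputs and outcomes as above, for every positive integer $T$ and for every $f\in\mathcal F$, $$\sum_{t=1}^T \frac{\beta_t}{\beta_T}(\gamma_t-y_t)^2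 \le \sum_{t=1}^T \frac{\beta_t}{\beta_T}(f(x_t)-y_t)^2 + a\|f\|^2 + \frac{(Y_2-Y_1)^2}{4}\ln\det\left(\frac{\sqrt{W_T}\,\mathbf K_T\sqrt{W_T}}{a}+I\right).$$ -/

import Mathlib

namespace DiscountedRegression

/-- A (deterministic) strategy of Learner in online regression with input space `X` and discount
factors announced step by step. At step `t = 1, 2, …` the prediction may depend on the discount
factors `α 0, …, α (t - 1)`, on the inputs `x 1, …, x t` and on the outcomes `y 1, …, y (t - 1)`,
and on nothing else. (Learner's own earlier predictions are functions of these data.) -/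
abbrev Strategy (X : Type*) : Type _ :=
  (t : ℕ) → (Finset.range t → ℝ) → (Finset.Icc 1 t → X) → (Finset.Ico 1 t → ℝ) → ℝ

/-- The prediction `γ_t` which the strategy `σ` makes at step `t` when the opponents announce the
discount factors `α`, the inputs `x` and the outcomes `y`. Inputs and outcomes are numbered
from `1`; the values `x 0` and `y 0` play no role. -/
def prediction {X : Type*} (σ : Strategy X) (α : ℕ → ℝ) (x : ℕ → X) (y : ℕ → ℝ) (t : ℕ) : ℝ :=
  σ t (fun i => α i) (fun i => x i) (fun i => y i)

/-- `β_t = 1 / (α_1 ⋯ α_{t-1})`, so that `β_1 = 1`. -/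
noncomputable def beta (α : ℕ → ℝ) (t : ℕ) : ℝ :=
  (∏ i ∈ Finset.Ico 1 t, α i)⁻¹

/-- The square root of the diagonal weight matrix `W_T = diag (β_1 / β_T, …, β_T / β_T)`. -/
noncomputable def sqrtWeightMatrix (α : ℕ → ℝ) (T : ℕ) :
    Matrix (Finset.Icc 1 T) (Finset.Icc 1 T) ℝ :=
  Matrix.diagonal fun t => √(beta α t / beta α T)

/-- The scalar kernel `k : X × X → ℝ` of a reproducing kernel Hilbert space `F` of real functions
on `X`. (The kernel in Mathlib is valued in the continuous linear maps `ℝ →L[ℝ] ℝ`.) -/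
noncomputable def scalarKernel (F : Type*) {X : Type*} [NormedAddCommGroup F]
    [InnerProductSpace ℝ F] [CompleteSpace F] [RKHS ℝ F X ℝ] (x x' : X) : ℝ :=
  RKHS.kernel F x x' 1

/-- The kernel matrix `K_T = (k (x_i, x_j))` with `i, j = 1, …, T`. -/
noncomputable def kernelMatrix (F : Type*) {X : Type*} [NormedAddCommGroup F]
    [InnerProductSpace ℝ F] [CompleteSpace F] [RKHS ℝ F X ℝ] (x : ℕ → X) (T : ℕ) :
    Matrix (Finset.Icc 1 T) (Finset.Icc 1 T) ℝ :=
  Matrix.of fun i j => scalarKernel F (x i) (x j)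

end DiscountedRegression

/-! Learner computes the ridge prediction `m` from the weighted past and shrinks it towards the
centre of `[Y₁, Y₂]` by the factor `1 + v`, where `v = ⟪k, r⟫`, `k` is the new feature and `r`
solves `regOp a u r = k`. A new observation of weight one raises the ridge minimum by at least `(m -
y)² / (1 + v)` (`ridgeEnergy_add_le`) and multiplies the regularized Gram determinant by `1 + v`
(`det_regGram_sumElim`). By `shrunk_sq_error_le`, the loss is therefore at most the rise of the
minimum plus `(Y₂ - Y₁)² / 4` times the rise of the log-determinant, and these rises telescope.
Discounting multiplies the bound for the past by some `r ≤ 1`: losses scale exactly, the penalty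
`a‖f‖²` only shrinks, and `r log det (G + 1) ≤ log det (rG + 1)` (`mul_log_det_add_one_le`). -/

open scoped InnerProductSpace

namespace DiscountedRegression

/-! ### Ridge regression in an inner product space -/

section Ridge

variable {E : Type*} [NormedAddCommGroup E] [InnerProductSpace ℝ E]
variable {ι : Type*} [Fintype ι]

/-- The regularized covariance operator `a + ∑ i, u i ⊗ u i` of the features `u`. -/
noncomputable def regOp (a : ℝ) (u : ι → E) (h : E) : E :=
  a • h + ∑ i, ⟪u i, h⟫_ℝ • u i

/-- The objective of ridge regression with features `u` and targets `z`. -/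
noncomputable def ridgeEnergy (a : ℝ) (u : ι → E) (z : ι → ℝ) (f : E) : ℝ :=
  ∑ i, (⟪u i, f⟫_ℝ - z i) ^ 2 + a * ‖f‖ ^ 2

lemma inner_regOp (a : ℝ) (u : ι → E) (g h : E) :
    ⟪g, regOp a u h⟫_ℝ = a * ⟪g, h⟫_ℝ + ∑ i, ⟪u i, h⟫_ℝ * ⟪u i, g⟫_ℝ := by
  simp only [regOp, inner_add_right, inner_sum, real_inner_smul_right, real_inner_comm g]

lemma inner_regOp_self_nonneg {a : ℝ} (ha : 0 ≤ a) (u : ι → E) (g : E) :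
    0 ≤ ⟪g, regOp a u g⟫_ℝ := by
  rw [inner_regOp, real_inner_self_eq_norm_sq]
  exact add_nonneg (by positivity) (Finset.sum_nonneg fun i _ => mul_self_nonneg _)

lemma inner_regOp_comm (a : ℝ) (u : ι → E) (g h : E) :
    ⟪g, regOp a u h⟫_ℝ = ⟪h, regOp a u g⟫_ℝ := by
  simp only [inner_regOp, real_inner_comm g h, mul_comm]

lemma regOp_sub (a : ℝ) (u : ι → E) (g h : E) :
    regOp a u (g - h) = regOp a u g - regOp a u h := by
  simp only [regOp, inner_sub_right, sub_smul, smul_sub, Finset.sum_sub_distrib]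
  abel

lemma regOp_smul (a c : ℝ) (u : ι → E) (h : E) :
    regOp a u (c • h) = c • regOp a u h := by
  simp only [regOp, real_inner_smul_right, smul_add, Finset.smul_sum, smul_smul, mul_comm]

/-- A solution of the normal equations minimizes the ridge objective. -/
lemma ridgeEnergy_eq_add {a : ℝ} {u : ι → E} {z : ι → ℝ} {f₀ : E}
    (hf₀ : regOp a u f₀ = ∑ i, z i • u i) (f : E) :
    ridgeEnergy a u z f =
      ridgeEnergy a u z f₀ + ⟪f - f₀, regOp a u (f - f₀)⟫_ℝ := by
  obtain ⟨g, rfl⟩ : ∃ g, f = f₀ + g := ⟨f - f₀, by abel⟩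
  have h : ⟪g, regOp a u f₀⟫_ℝ = ⟪g, ∑ i, z i • u i⟫_ℝ := by rw [hf₀]
  simp only [inner_regOp, inner_sum, real_inner_smul_right] at h
  simp only [real_inner_comm _ g] at h
  have hs : ∑ i, (⟪u i, f₀ + g⟫_ℝ - z i) ^ 2 = ∑ i, (⟪u i, f₀⟫_ℝ - z i) ^ 2
      + ∑ i, ⟪u i, g⟫_ℝ * ⟪u i, g⟫_ℝ
      + 2 * (∑ i, ⟪u i, f₀⟫_ℝ * ⟪u i, g⟫_ℝ - ∑ i, z i * ⟪u i, g⟫_ℝ) := by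
    rw [← Finset.sum_sub_distrib, Finset.mul_sum, ← Finset.sum_add_distrib,
      ← Finset.sum_add_distrib]
    refine Finset.sum_congr rfl fun i _ => ?_
    rw [inner_add_right]
    ring
  have hn : ‖f₀ + g‖ ^ 2 = ‖f₀‖ ^ 2 + 2 * ⟪f₀, g⟫_ℝ + ‖g‖ ^ 2 := norm_add_sq_real f₀ g
  simp only [ridgeEnergy, add_sub_cancel_left, inner_regOp, real_inner_self_eq_norm_sq, hs, hn]
  linarith

/-- Adding one observation to a ridge regression problem raises the minimum by at least the
rescaled squared error of the old solution. -/
lemma ridgeEnergy_add_le {a : ℝ} (ha : 0 ≤ a) {u : ι → E} {z : ι → ℝ} {f₀ r k : E}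
    (hf₀ : regOp a u f₀ = ∑ i, z i • u i) (hr : regOp a u r = k) (y : ℝ) (f : E) :
    ridgeEnergy a u z f₀ + (⟪k, f₀⟫_ℝ - y) ^ 2 / (1 + ⟪k, r⟫_ℝ) ≤
      ridgeEnergy a u z f + (⟪k, f⟫_ℝ - y) ^ 2 := by
  rw [ridgeEnergy_eq_add hf₀ f]
  obtain ⟨g, rfl⟩ : ∃ g, f = f₀ + g := ⟨f - f₀, by abel⟩
  rw [add_sub_cancel_left, inner_add_right]
  have hv : 0 ≤ ⟪k, r⟫_ℝ := by
    have := inner_regOp_self_nonneg ha u r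
    rwa [hr, real_inner_comm] at this
  generalize hq : ⟪k, f₀⟫_ℝ - y = q
  have hpos : (0 : ℝ) < 1 + ⟪k, r⟫_ℝ := by linarith
  -- The optimal perturbation is `g = s • r`. Positivity at `g - s • r` leaves only the square `(⟪k,
  -- g⟫ - s * ⟪k, r⟫)²`.
  obtain ⟨s, hs⟩ : ∃ s, q = -s * (1 + ⟪k, r⟫_ℝ) := ⟨-q / (1 + ⟪k, r⟫_ℝ), by field_simp⟩
  have hE := inner_regOp_self_nonneg ha u (g - s • r)
  rw [regOp_sub, regOp_smul, hr, inner_sub_left, inner_sub_right, inner_sub_right,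
    real_inner_smul_left, real_inner_smul_left, real_inner_smul_right, real_inner_smul_right,
    inner_regOp_comm a u r g, hr, real_inner_comm k g, real_inner_comm k r] at hE
  have hdiv : q ^ 2 / (1 + ⟪k, r⟫_ℝ) = s ^ 2 * (1 + ⟪k, r⟫_ℝ) := by
    rw [hs]; field_simp
  have hy : ⟪k, f₀⟫_ℝ + ⟪k, g⟫_ℝ - y = ⟪k, g⟫_ℝ + q := by rw [← hq]; ring
  rw [hdiv, hy, hs]
  nlinarith [sq_nonneg (⟪k, g⟫_ℝ - s * ⟪k, r⟫_ℝ)]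

variable [DecidableEq ι]

/-- The matrix `G / a + 1`, where `G` is the Gram matrix of the features `u`. -/
noncomputable def regGram (a : ℝ) (u : ι → E) : Matrix ι ι ℝ :=
  a⁻¹ • Matrix.gram ℝ u + 1

lemma regGram_posDef {a : ℝ} (ha : 0 < a) (u : ι → E) : (regGram a u).PosDef :=
  Matrix.PosDef.posSemidef_add
    ((Matrix.posSemidef_gram ℝ u).smul (inv_nonneg.mpr ha.le)) Matrix.PosDef.one

lemma regGram_mulVec (a : ℝ) (u : ι → E) (c : ι → ℝ) (j : ι) :
    (regGram a u).mulVec c j = a⁻¹ * ∑ i, c i * ⟪u j, u i⟫_ℝ + c j := by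
  rw [regGram, Matrix.add_mulVec, Matrix.smul_mulVec, Matrix.one_mulVec]
  simp [Matrix.mulVec, dotProduct, Matrix.gram_apply, mul_comm]

/-- The inverse of `regOp`, computed from the Gram matrix. -/
noncomputable def regInv (a : ℝ) (u : ι → E) (h : E) : E :=
  a⁻¹ • (h - ∑ i, ((regGram a u)⁻¹.mulVec fun i => a⁻¹ * ⟪u i, h⟫_ℝ) i • u i)

/-- Woodbury identity: the coefficients `c` are chosen so that `⟪u j, regInv a u h⟫ = c j`, and the
rank-one terms then cancel. -/
lemma regOp_regInv {a : ℝ} (ha : 0 < a) (u : ι → E) (h : E) :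
    regOp a u (regInv a u h) = h := by
  unfold regInv
  set c := (regGram a u)⁻¹.mulVec fun i => a⁻¹ * ⟪u i, h⟫_ℝ with hc
  have hM : (regGram a u).mulVec c = fun i => a⁻¹ * ⟪u i, h⟫_ℝ := by
    rw [hc, Matrix.mulVec_mulVec, Matrix.mul_nonsing_inv _
      (isUnit_iff_ne_zero.mpr (regGram_posDef ha u).det_pos.ne'), Matrix.one_mulVec]
  have hcj (j : ι) : ⟪u j, a⁻¹ • (h - ∑ i, c i • u i)⟫_ℝ = c j := by
    have := congrFun hM j
    rw [regGram_mulVec] at this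
    simp only [real_inner_smul_right, inner_sub_right, inner_sum]
    linarith
  simp only [regOp, hcj, smul_smul, mul_inv_cancel₀ ha.ne', one_smul, sub_add_cancel]

/-- Adding a feature `k` multiplies the determinant of `regGram` by `1 + ⟪k, r⟫`, where `r` is the
solution of `regOp a u r = k`. -/
lemma det_regGram_sumElim {a : ℝ} (ha : 0 < a) {u : ι → E} {k r : E} (hr : regOp a u r = k) :
    (regGram a (Sum.elim u fun _ : PUnit.{1} => k)).det =
      (regGram a u).det * (1 + ⟪k, r⟫_ℝ) := by
  have hblock : regGram a (Sum.elim u fun _ : PUnit.{1} => k) =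
      Matrix.fromBlocks (regGram a u) (Matrix.of fun i _ => a⁻¹ * ⟪u i, k⟫_ℝ)
        (Matrix.of fun _ i => a⁻¹ * ⟪k, u i⟫_ℝ)
        (Matrix.of fun _ _ => a⁻¹ * ⟪k, k⟫_ℝ + 1) := by
    ext (i | i) (j | j) <;> simp [regGram, Matrix.gram_apply, Matrix.one_apply]
  have hdet : IsUnit (regGram a u).det :=
    isUnit_iff_ne_zero.mpr (regGram_posDef ha u).det_pos.ne'
  let _ := Matrix.invertibleOfIsUnitDet _ hdet
  -- Pairing `regOp a u r = k` with `u j` writes the border column as `regGram a u` times a vector,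
  -- so the inverse cancels in the Schur complement.
  have hcol : (Matrix.of fun i (_ : PUnit.{1}) => a⁻¹ * ⟪u i, k⟫_ℝ) =
      regGram a u * Matrix.of fun i _ => ⟪u i, r⟫_ℝ := by
    ext j _
    refine Eq.trans ?_ (regGram_mulVec a u (fun i => ⟪u i, r⟫_ℝ) j).symm
    rw [Matrix.of_apply, ← hr, inner_regOp]
    simp only [real_inner_comm _ (u j)]
    field_simp
    ring
  have hkk : ⟪k, r⟫_ℝ = a⁻¹ * ⟪k, k⟫_ℝ - a⁻¹ * ∑ i, ⟪u i, r⟫_ℝ * ⟪u i, k⟫_ℝ := by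
    have : ⟪k, k⟫_ℝ = a * ⟪k, r⟫_ℝ + ∑ i, ⟪u i, r⟫_ℝ * ⟪u i, k⟫_ℝ := by
      rw [← inner_regOp, hr]
    rw [this]
    field_simp
    ring
  rw [hblock, Matrix.det_fromBlocks₁₁, hcol, Matrix.mul_assoc, Matrix.invOf_mul_cancel_left,
    Matrix.det_unique (_ - _), Matrix.sub_apply, Matrix.mul_apply, hkk, Finset.mul_sum]
  simp only [Matrix.of_apply, real_inner_comm _ k]
  congr 1
  rw [add_comm, add_sub_assoc]
  congr 2
  exact Finset.sum_congr rfl fun i _ => by ring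

end Ridge

/-! ### Scalar and determinant inequalities -/

/-- `log det (1 + G)` is a concave function of the scale of a positive semidefinite `G`. -/
lemma mul_log_det_add_one_le {ι : Type*} [Fintype ι] [DecidableEq ι] {G : Matrix ι ι ℝ}
    (hG : G.PosSemidef) {r : ℝ} (hr0 : 0 ≤ r) (hr1 : r ≤ 1) :
    r * Real.log (G + 1).det ≤ Real.log (r • G + 1).det := by
  have hdet (s : ℝ) : (s • G + 1).det = ∏ i, (1 + s * hG.1.eigenvalues i) := by
    set U := hG.1.eigenvectorUnitary
    have hU : (U : Matrix ι ι ℝ) * star (U : Matrix ι ι ℝ) = 1 := Unitary.mul_star_self_of_mem U.2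
    have : s • G + 1 = (U : Matrix ι ι ℝ) *
        Matrix.diagonal (fun i => 1 + s * hG.1.eigenvalues i) * star (U : Matrix ι ι ℝ) := by
      have hd : Matrix.diagonal (fun i => 1 + s * hG.1.eigenvalues i) =
          s • Matrix.diagonal hG.1.eigenvalues + (1 : Matrix ι ι ℝ) := by
        ext i j
        by_cases h : i = j <;> simp [h, add_comm]
      rw [hd, mul_add, add_mul, mul_one, hU, mul_smul_comm, smul_mul_assoc]
      congr 2
      exact hG.1.spectral_theorem
    rw [this, Matrix.det_mul, Matrix.det_mul, mul_right_comm, ← Matrix.det_mul, hU,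
      Matrix.det_one, one_mul, Matrix.det_diagonal]
  have h1 := hdet 1
  rw [one_smul] at h1
  have hev := hG.eigenvalues_nonneg
  rw [h1, hdet, Real.log_prod fun i _ => by have := hev i; positivity,
    Real.log_prod fun i _ => by have := hev i; positivity, Finset.mul_sum]
  refine Finset.sum_le_sum fun i _ => ?_
  have hi := hev i
  -- Bernoulli's inequality `(1 + c) ^ r ≤ 1 + r * c` for each eigenvalue `c`.
  rw [one_mul, ← Real.log_rpow (by positivity)]
  exact Real.log_le_log (by positivity)
    (rpow_one_add_le_one_add_mul_self (by linarith) hr0 hr1)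

/-- Shrinking the prediction `m` towards the centre of the interval of outcomes makes up for the
factor `1 + v` by which the squared error of `m` is divided. -/
lemma shrunk_sq_error_le {Y₁ Y₂ m v y : ℝ} (hv : 0 ≤ v) (hy : y ∈ Set.Icc Y₁ Y₂) :
    ((Y₁ + Y₂) / 2 + (m - (Y₁ + Y₂) / 2) / (1 + v) - y) ^ 2 ≤
      (m - y) ^ 2 / (1 + v) + (Y₂ - Y₁) ^ 2 / 4 * Real.log (1 + v) := by
  have hpos : 0 < 1 + v := by linarith
  have hlog := Real.one_sub_inv_le_log_of_pos hpos
  have hp0 : 0 < (1 + v)⁻¹ := inv_pos.mpr hpos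
  have hp1 : (1 + v)⁻¹ ≤ 1 := inv_le_one_of_one_le₀ (by linarith)
  rw [div_eq_mul_inv _ (1 + v), div_eq_mul_inv _ (1 + v)]
  generalize (1 + v)⁻¹ = p at *
  obtain ⟨e, rfl⟩ : ∃ e, m = (Y₁ + Y₂) / 2 + e := ⟨m - (Y₁ + Y₂) / 2, by ring⟩
  obtain ⟨z, rfl⟩ : ∃ z, y = (Y₁ + Y₂) / 2 + z := ⟨y - (Y₁ + Y₂) / 2, by ring⟩
  have hz : z ^ 2 ≤ (Y₂ - Y₁) ^ 2 / 4 := by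
    nlinarith [mul_nonneg (sub_nonneg.mpr hy.1) (sub_nonneg.mpr hy.2)]
  -- With `p = 1 / (1 + v)` the cross terms cancel: `p(e - z)² - (pe - z)² = p(1 - p)e² - (1 -
  -- p)z²`.
  have h1 : z ^ 2 * (1 - p) ≤ (Y₂ - Y₁) ^ 2 / 4 * Real.log (1 + v) :=
    mul_le_mul hz hlog (by linarith) (by positivity)
  have h2 : 0 ≤ e ^ 2 * (p * (1 - p)) :=
    mul_nonneg (sq_nonneg e) (mul_nonneg hp0.le (by linarith))
  nlinarith

/-! ### The discounted protocol and its regret bound -/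

section Protocol

variable {X F : Type*} [NormedAddCommGroup F] [InnerProductSpace ℝ F]

/-- The prediction of ridge regression at the feature `k`, shrunk towards `(Y₁ + Y₂) / 2`. -/
noncomputable def shrunkRidge {ι : Type*} [Fintype ι] [DecidableEq ι] (Y₁ Y₂ a : ℝ) (u : ι → F)
    (z : ι → ℝ) (k : F) : ℝ :=
  (Y₁ + Y₂) / 2 +
    (⟪k, regInv a u (∑ i, z i • u i)⟫_ℝ - (Y₁ + Y₂) / 2) / (1 + ⟪k, regInv a u k⟫_ℝ)

lemma shrunkRidge_sq_error_le {ι : Type*} [Fintype ι] [DecidableEq ι] {Y₁ Y₂ a y : ℝ} (ha : 0 < a)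
    (hy : y ∈ Set.Icc Y₁ Y₂) (u : ι → F) (z : ι → ℝ) (k : F) :
    ∃ f₀ : F, ∀ f : F, ridgeEnergy a u z f₀ + (shrunkRidge Y₁ Y₂ a u z k - y) ^ 2 +
        (Y₂ - Y₁) ^ 2 / 4 * Real.log (regGram a u).det ≤
      ridgeEnergy a u z f + (⟪k, f⟫_ℝ - y) ^ 2 + (Y₂ - Y₁) ^ 2 / 4 *
        Real.log (regGram a (Sum.elim u fun _ : PUnit.{1} => k)).det := by
  refine ⟨regInv a u (∑ i, z i • u i), fun f => ?_⟩
  have hr := regOp_regInv ha u k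
  have hv : 0 ≤ ⟪k, regInv a u k⟫_ℝ := by
    have := inner_regOp_self_nonneg ha.le u (regInv a u k)
    rwa [hr, real_inner_comm] at this
  have h1 := ridgeEnergy_add_le ha.le (regOp_regInv ha u (∑ i, z i • u i)) hr y f
  have h2 := shrunk_sq_error_le (m := ⟪k, regInv a u (∑ i, z i • u i)⟫_ℝ) hv hy
  rw [det_regGram_sumElim ha hr, Real.log_mul (regGram_posDef ha u).det_pos.ne' (by positivity)]
  unfold shrunkRidge
  linarith

/-- `log det (G / a + 1)` for the Gram matrix `G` of the features `u i`, `i ∈ s`. -/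
noncomputable def logDet (a : ℝ) (s : Finset ℕ) (u : ℕ → F) : ℝ :=
  Real.log (regGram a fun i : s => u i).det

lemma logDet_empty (a : ℝ) (u : ℕ → F) : logDet a ∅ u = 0 := by
  rw [logDet, Matrix.det_isEmpty, Real.log_one]

lemma logDet_insert (a : ℝ) {s : Finset ℕ} {t : ℕ} (ht : t ∉ s) (u : ℕ → F) :
    logDet a (insert t s) u =
      Real.log (regGram a (Sum.elim (fun i : s => u i) fun _ : PUnit.{1} => u t)).det := by
  let e : {i // i ∈ insert t s} ≃ s ⊕ PUnit.{1} :=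
    (Finset.subtypeInsertEquivOption ht).trans (Equiv.optionEquivSumPUnit _)
  rw [logDet, ← Matrix.det_submatrix_equiv_self e.symm]
  congr 2
  have he : ∀ j, u (e.symm j : ℕ) = Sum.elim (fun i : s => u i) (fun _ : PUnit.{1} => u t) j := by
    rintro (j | j) <;> simp [e, Finset.subtypeInsertEquivOption]
  ext i j
  simp [regGram, Matrix.gram_apply, he, Matrix.one_apply]

lemma mul_logDet_le {a : ℝ} (ha : 0 < a) (s : Finset ℕ) {u v : ℕ → F} {r : ℝ} (hr0 : 0 ≤ r)
    (hr1 : r ≤ 1) (huv : ∀ i ∈ s, v i = √r • u i) :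
    r * logDet a s u ≤ logDet a s v := by
  have h := mul_log_det_add_one_le
    ((Matrix.posSemidef_gram ℝ fun i : s => u i).smul (inv_nonneg.mpr ha.le)) hr0 hr1
  refine h.trans_eq ?_
  unfold logDet
  congr 2
  ext i j
  simp only [regGram, Matrix.add_apply, Matrix.smul_apply, Matrix.gram_apply, huv i i.2, huv j j.2,
    real_inner_smul_left, real_inner_smul_right, smul_eq_mul]
  rw [← mul_assoc (√r), Real.mul_self_sqrt hr0]
  ring

lemma beta_pos {α : ℕ → ℝ} (hα : ∀ t, α t ∈ Set.Ioc (0 : ℝ) 1) (t : ℕ) : 0 < beta α t :=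
  inv_pos.mpr (Finset.prod_pos fun i _ => (hα i).1)

lemma beta_div_succ_le_one {α : ℕ → ℝ} (hα : ∀ t, α t ∈ Set.Ioc (0 : ℝ) 1) (n : ℕ) :
    beta α n / beta α (n + 1) ≤ 1 := by
  rw [div_le_one (beta_pos hα _)]
  refine inv_anti₀ (Finset.prod_pos fun i _ => (hα i).1) ?_
  -- At `n = 0`, where the induction starts, both products are empty.
  rcases Nat.eq_zero_or_pos n with rfl | hn
  · simp
  · rw [Finset.prod_Ico_succ_top hn]
    exact mul_le_of_le_one_right (Finset.prod_nonneg fun i _ => (hα i).1.le) (hα n).2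

/-- Shows that the weights used at step `t` depend only on the discount factors already announced.
-/
lemma beta_div {α : ℕ → ℝ} (hα : ∀ t, α t ∈ Set.Ioc (0 : ℝ) 1) {i t : ℕ} (hi : 1 ≤ i)
    (hit : i ≤ t) :
    beta α i / beta α t = ∏ j : Finset.range t, if i ≤ j then α j else 1 := by
  have h : (∏ j : Finset.range t, if i ≤ (j : ℕ) then α j else 1) = ∏ j ∈ Finset.Ico i t, α j := by
    rw [Finset.prod_coe_sort (Finset.range t) fun j => if i ≤ j then α j else 1,
      ← Finset.prod_filter]
    refine Finset.prod_congr ?_ fun _ _ => rfl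
    ext j
    simp [and_comm]
  rw [h, beta, beta, ← Finset.prod_Ico_consecutive α hi hit]
  have h1 : ∏ j ∈ Finset.Ico 1 i, α j ≠ 0 := Finset.prod_ne_zero_iff.mpr fun j _ => (hα j).1.ne'
  field_simp

variable [CompleteSpace F] [RKHS ℝ F X ℝ]

lemma inner_kerFun_one (x : X) (f : F) : ⟪RKHS.kerFun F x (1 : ℝ), f⟫_ℝ = f x := by
  simp

/-- Learner's strategy: kernel ridge regression with the discounted weights, shrunk towards the
centre of the interval of outcomes. -/
noncomputable def shrunkRidgeStrategy (F : Type*) [NormedAddCommGroup F] [InnerProductSpace ℝ F]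
    [CompleteSpace F] [RKHS ℝ F X ℝ] (Y₁ Y₂ a : ℝ) : Strategy X := fun t α x y =>
  if ht : 1 ≤ t then
    shrunkRidge Y₁ Y₂ a
      (fun i : Finset.Ico 1 t => √(∏ j : Finset.range t, if (i : ℕ) ≤ (j : ℕ) then α j else 1) •
        RKHS.kerFun F (x ⟨i, Finset.Ico_subset_Icc_self i.2⟩) (1 : ℝ))
      (fun i : Finset.Ico 1 t => √(∏ j : Finset.range t, if (i : ℕ) ≤ (j : ℕ) then α j else 1) * y i)
      (RKHS.kerFun F (x ⟨t, Finset.right_mem_Icc.mpr ht⟩) (1 : ℝ))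
  else 0

/-- The discounted feature of the input `x i`, as seen at step `t`. -/
noncomputable def feature (F : Type*) [NormedAddCommGroup F] [InnerProductSpace ℝ F]
    [CompleteSpace F] [RKHS ℝ F X ℝ] (α : ℕ → ℝ) (x : ℕ → X) (t i : ℕ) : F :=
  √(beta α i / beta α t) • RKHS.kerFun F (x i) (1 : ℝ)

lemma prediction_shrunkRidgeStrategy {α : ℕ → ℝ} (hα : ∀ t, α t ∈ Set.Ioc (0 : ℝ) 1) (x : ℕ → X)
    (y : ℕ → ℝ) (Y₁ Y₂ a : ℝ) {t : ℕ} (ht : 1 ≤ t) :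
    prediction (shrunkRidgeStrategy F Y₁ Y₂ a) α x y t =
      shrunkRidge Y₁ Y₂ a (fun i : Finset.Ico 1 t => feature F α x t i)
        (fun i => √(beta α i / beta α t) * y i) (RKHS.kerFun F (x t) (1 : ℝ)) := by
  have h (i : Finset.Ico 1 t) := beta_div hα (Finset.mem_Ico.mp i.2).1 (Finset.mem_Ico.mp i.2).2.le
  simp only [prediction, shrunkRidgeStrategy, dif_pos ht, feature, h]

lemma ridgeEnergy_feature {α : ℕ → ℝ} (hα : ∀ t, α t ∈ Set.Ioc (0 : ℝ) 1) (x : ℕ → X) (y : ℕ → ℝ)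
    (a : ℝ) (t : ℕ) (f : F) :
    ridgeEnergy a (fun i : Finset.Ico 1 t => feature F α x t i)
        (fun i => √(beta α i / beta α t) * y i) f =
      ∑ i ∈ Finset.Ico 1 t, beta α i / beta α t * (f (x i) - y i) ^ 2 + a * ‖f‖ ^ 2 := by
  rw [ridgeEnergy, ← Finset.sum_coe_sort (Finset.Ico 1 t)]
  congr 1
  refine Finset.sum_congr rfl fun i _ => ?_
  rw [feature, real_inner_smul_left, inner_kerFun_one, ← mul_sub, mul_pow,
    Real.sq_sqrt (div_pos (beta_pos hα _) (beta_pos hα _)).le]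

/-- Rescaling all the weights from step `t` to step `t'`. -/
lemma sum_beta_div_eq {α : ℕ → ℝ} (hα : ∀ t, α t ∈ Set.Ioc (0 : ℝ) 1) (s : Finset ℕ) (t t' : ℕ)
    (g : ℕ → ℝ) :
    ∑ i ∈ s, beta α i / beta α t' * g i =
      beta α t / beta α t' * ∑ i ∈ s, beta α i / beta α t * g i := by
  rw [Finset.mul_sum]
  refine Finset.sum_congr rfl fun i _ => ?_
  have := (beta_pos hα t).ne'
  field_simp

/-- The regret bound for the discounted kernel ridge strategy. -/
theorem discounted_loss_le {Y₁ Y₂ a : ℝ} (ha : 0 < a) {α : ℕ → ℝ} {x : ℕ → X} {y : ℕ → ℝ}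
    (hα : ∀ t, α t ∈ Set.Ioc (0 : ℝ) 1) (hy : ∀ t, 1 ≤ t → y t ∈ Set.Icc Y₁ Y₂) (n : ℕ) (f : F) :
    ∑ t ∈ Finset.Icc 1 n, beta α t / beta α n *
        (prediction (shrunkRidgeStrategy F Y₁ Y₂ a) α x y t - y t) ^ 2 ≤
      ∑ t ∈ Finset.Icc 1 n, beta α t / beta α n * (f (x t) - y t) ^ 2 + a * ‖f‖ ^ 2 +
        (Y₂ - Y₁) ^ 2 / 4 * logDet a (Finset.Icc 1 n) (feature F α x n) := by
  induction n generalizing f with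
  | zero =>
    rw [Finset.Icc_eq_empty (by norm_num), logDet_empty]
    simp only [Finset.sum_empty]
    positivity
  | succ n ih =>
    have hIco : Finset.Icc 1 n = Finset.Ico 1 (n + 1) := by ext; simp
    have hIcc : Finset.Icc 1 (n + 1) = insert (n + 1) (Finset.Ico 1 (n + 1)) := by
      ext; simp
    have hmem : n + 1 ∉ Finset.Ico 1 (n + 1) := by simp
    have h1 : beta α (n + 1) / beta α (n + 1) = 1 := div_self (beta_pos hα _).ne'
    rw [hIco] at ih
    rw [hIcc, Finset.sum_insert hmem, Finset.sum_insert hmem, h1, one_mul, one_mul,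
      logDet_insert a hmem]
    obtain ⟨f₀, hf₀⟩ := shrunkRidge_sq_error_le ha (hy (n + 1) n.succ_pos)
      (fun i : Finset.Ico 1 (n + 1) => feature F α x (n + 1) i)
      (fun i => √(beta α i / beta α (n + 1)) * y i) (RKHS.kerFun F (x (n + 1)) (1 : ℝ))
    specialize hf₀ f
    rw [← prediction_shrunkRidgeStrategy hα x y Y₁ Y₂ a n.succ_pos, ridgeEnergy_feature hα,
      ridgeEnergy_feature hα, inner_kerFun_one] at hf₀
    have hlast : feature F α x (n + 1) (n + 1) = RKHS.kerFun F (x (n + 1)) (1 : ℝ) := by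
      rw [feature, h1, Real.sqrt_one, one_smul]
    rw [hlast]
    set r := beta α n / beta α (n + 1) with hr
    have hr0 : 0 ≤ r := (div_pos (beta_pos hα _) (beta_pos hα _)).le
    have hr1 : r ≤ 1 := beta_div_succ_le_one hα n
    have hscale := mul_logDet_le ha (Finset.Ico 1 (n + 1)) (u := feature F α x n)
      (v := feature F α x (n + 1)) hr0 hr1 fun i _ => by
        rw [feature, feature, smul_smul, ← Real.sqrt_mul hr0]
        congr 2
        have := (beta_pos hα n).ne'
        rw [hr]
        field_simp
    have hscale' := mul_le_mul_of_nonneg_left hscale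
      (by positivity : (0 : ℝ) ≤ (Y₂ - Y₁) ^ 2 / 4)
    -- The old bound is needed at the past minimizer `f₀`, not at `f`; this is why the induction
    -- generalizes over `f`.
    have hih := mul_le_mul_of_nonneg_left (ih f₀) hr0
    have hreg : r * (a * ‖f₀‖ ^ 2) ≤ a * ‖f₀‖ ^ 2 := mul_le_of_le_one_left (by positivity) hr1
    rw [sum_beta_div_eq hα _ n (n + 1) fun t =>
      (prediction (shrunkRidgeStrategy F Y₁ Y₂ a) α x y t - y t) ^ 2, ← hr]
    rw [sum_beta_div_eq hα _ n (n + 1) fun t => (f₀ (x t) - y t) ^ 2, ← hr] at hf₀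
    change _ + _ * logDet a (Finset.Ico 1 (n + 1)) (feature F α x (n + 1)) ≤ _ at hf₀
    linarith

lemma regGram_feature (α : ℕ → ℝ) (x : ℕ → X) (a : ℝ) (T : ℕ) :
    regGram a (fun i : Finset.Icc 1 T => feature F α x T i) =
      a⁻¹ • (sqrtWeightMatrix α T * kernelMatrix F x T * sqrtWeightMatrix α T) + 1 := by
  rw [regGram]
  congr 2
  ext i j
  rw [sqrtWeightMatrix, Matrix.mul_diagonal, Matrix.diagonal_mul, kernelMatrix, Matrix.of_apply,
    scalarKernel, ← RKHS.kerFun_apply, Matrix.gram_apply, feature, feature, real_inner_smul_left,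
    real_inner_smul_right, inner_kerFun_one]
  ring

end Protocol

end DiscountedRegression

theorem theorem5 {X : Type*} {F : Type*} [NormedAddCommGroup F] [InnerProductSpace ℝ F]
    [CompleteSpace F] [RKHS ℝ F X ℝ] (Y₁ Y₂ : ℝ) (a : ℝ) (ha : 0 < a) :
    ∃ σ : DiscountedRegression.Strategy X,
      ∀ (α : ℕ → ℝ) (x : ℕ → X) (y : ℕ → ℝ),
        (∀ t, α t ∈ Set.Ioc (0 : ℝ) 1) →
        (∀ t, 1 ≤ t → y t ∈ Set.Icc Y₁ Y₂) →
        ∀ T : ℕ, 1 ≤ T → ∀ f : F,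
          ∑ t ∈ Finset.Icc 1 T, DiscountedRegression.beta α t / DiscountedRegression.beta α T *
              (DiscountedRegression.prediction σ α x y t - y t) ^ 2 ≤
            ∑ t ∈ Finset.Icc 1 T, DiscountedRegression.beta α t / DiscountedRegression.beta α T *
                (f (x t) - y t) ^ 2
              + a * ‖f‖ ^ 2
              + (Y₂ - Y₁) ^ 2 / 4 *
                Real.log (a⁻¹ • (DiscountedRegression.sqrtWeightMatrix α T *
                    DiscountedRegression.kernelMatrix F x T *
                    DiscountedRegression.sqrtWeightMatrix α T) + 1).det := by
  refine ⟨DiscountedRegression.shrunkRidgeStrategy F Y₁ Y₂ a, fun α x y hα hy T _ f => ?_⟩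
  rw [← DiscountedRegression.regGram_feature]
  exact DiscountedRegression.discounted_loss_le ha hα hy T f
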